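/- Let $H$ be a real Hilbert space with an orthogonal almost complex structure $J$ ($J^2=-\mathrm{Id}$, $\langle Jx,Jy\rangle=\langle x,y\rangle$), regarded as a symplectic Hilbert space with the form $\omega(x,y)=\langle Jx,y\rangle$. Let $H_J$ be $H$ regarded as a complex Hilbert space by means of $J$, with Hermitian inner product $(x,y)=\langle x,y\rangle-\sqrt{-1}\,\langle Jx,y\rangle$. A subspace $\lambda\subset H$ is Lagrangian if $\lambda=\{x:\omega(x,y)=0\ \forall y\in\lambda\}$. For a Lagrangian subspace $\lambda$ let $\mathcal P(\lambda)$ and $\mathcal P(\lambda^\perp)$ be the orthogonal projections onto $\lambda$ and $\lambda^{\perp}$, and let $\tau_\lambda=2\mathcal P(\lambda)-\mathrm{Id}$. Lagrangian subspaces $\lambda,\theta$ almost coincide ($\lambda\sim\theta$) if $\dim\lambda/(\lambda\cap\theta)=\dim\theta/(\lambda\cap\theta)<\infty$. Let $\mathcal F\Lambda^{(0)}_\theta(H)$ be the set of Lagrangian subspaces $\mu$ such that $\mu\cap\theta=\{0\}$ and $\mu+\theta$ is closed and of finite codimension. $\det_F$ denotes the Fredholm determinant of operators of the form $\mathrm{Id}$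 + trace class. Let $\theta\sim\widetilde\theta$ be Lagrangian subspaces and let $\mu\in\mathcal F\Lambda^{(0)}_\theta(H)\cap\mathcal F\Lambda^{(0)}_{\widetilde\theta}(H)$. Then the operators $\mathcal P(\theta)\mp\mathcal P(\mu)$, $\mathcal P(\widetilde\theta)\mp\mathcal P(\mu)$, $\mathcal P(\theta^\perp)\mp\mathcal P(\mu^\perp)$, $\mathcal P(\widetilde\theta^\perp)\mp\mathcal P(\mu^\perp)$ are invertible on $H$, the products below are of the form $\mathrm{Id}$ + finite rank, and their Fredholm determinants on the real Hilbert space $H$ satisfy $$\begin{aligned} &\det{}_F\{(\mathcal P(\theta)-\mathcal P(\mu))(\mathcal P(\widetilde\theta)-\mathcal P(\mu))^{-1}\}\\ =\;&\det{}_F\{(\mathcal P(\theta^\perp)-\mathcal P(\mu^\perp))(\mathcal P(\widetilde\theta^\perp)-\mathcal P(\mu^\perp))^{-1}\}\\ =\;&\det{}_F\{(\mathcal P(\theta)+\mathcal P(\mu))(\mathcal P(\widetilde\theta)+\mathcal P(\mu))^{-1}\}\\ =\;&\det{}_F\{(\mathcal P(\theta^\perp)+\mathcal P(\mu^\perp))(\mathcal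 P(\widetilde\theta^\perp)+\mathcal P(\mu^\perp))^{-1}\}. \end{aligned}$$ Consequently, let $\lambda\sim\theta$ be a Lagrangian subspace, and put $q_\lambda(\mu)=\mathrm{Id}-\tau_\mu\tau_\lambda$ and $p_\lambda(\mu)=\mathcal P(\mu^\perp)+\mathcal P(\lambda^\perp)$; for $\vartheta\in\{\theta,\widetilde\theta\}$ put $A_\vartheta=-\mathrm{Id}+\tau_\vartheta\tau_\lambda$ and $B_\vartheta=\mathcal P(\vartheta^\perp)-\mathcal P(\lambda^\perp)$. The operators $A_\vartheta$, $B_\vartheta$ have finite rank, the operators $q_\lambda(\mu)+A_\vartheta$ and $p_\lambda(\mu)+B_\vartheta$ are invertible, the products below are of the form $\mathrm{Id}$ + finite rank, and the transition functions of the pull-backs of the determinant line bundle along $q_\lambda$ and along $p_\lambda$ (in the trivializations given by $A_\vartheta$ and $B_\vartheta$) agree when they are computed on the real Hilbert space $H$: $$\det{}_F\{(q_\lambda(\mu)+A_\theta)(q_\lambda(\mu)+A_{\widetilde\theta})^{-1}\}=\det{}_F\{(p_\lambda(\mu)+B_\theta)(p_\lambda(\mu)+B_{\widetilde\theta})^{-1}\}.$$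 If the transition function along $q_\lambda$ is instead computed with complex linear operators on the complex Hilbert space $H_J$, then the square of its absolute value is the transition function along $p_\lambda$: $$\bigl|\det{}_{F,H_J}\{(q_\lambda(\mu)+A_\theta)(q_\lambda(\mu)+A_{\widetilde\theta})^{-1}\}\bigr|^2=\det{}_F\{(p_\lambda(\mu)+B_\theta)(p_\lambda(\mu)+B_{\widetilde\theta})^{-1}\}.$$ -/

import Mathlib

open scoped RealInnerProductSpace Topology
open Filter

noncomputable section

namespace QuillenDet

/-! ### Fredholm determinants -/

section FredholmDeterminant

variable (𝕜 : Type*) [RCLike 𝕜] {E : Type*} [NormedAddCommGroup E] [InnerProductSpace 𝕜 E]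

/-- The compression `P_V T|_V : V → V` of an operator `T` to a finite dimensional subspace, namely
to the span `V` of a finite set `s` of vectors (`P_V` is the orthogonal projection onto `V`). -/
def compression (T : E →L[𝕜] E) (s : Finset E) :
    Submodule.span 𝕜 (s : Set E) →ₗ[𝕜] Submodule.span 𝕜 (s : Set E) :=
  ((Submodule.span 𝕜 (s : Set E)).orthogonalProjectionOnto ∘L T ∘L
    (Submodule.span 𝕜 (s : Set E)).subtypeL : _ →L[𝕜] _)

/-- The Fredholm determinant `det_F T` of an operator `T = Id + K`, with `K` of trace class, on a
real or complex Hilbert space: the limit of the ordinary determinants `det (Id_V + P_V K|_V)` along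
the directed system of all finite dimensional subspaces `V`. Since `P_V K P_V → K` in trace norm,
this is the extension of the finite dimensional determinant by continuity in trace norm. If `K` has
finite rank, the determinants are constant, equal to the determinant of `Id + K` on `V`, as soon as
`V` contains the range of `K`. -/
def detF (T : E →L[𝕜] E) : 𝕜 :=
  limUnder (atTop : Filter (Finset E)) fun s => LinearMap.det (compression 𝕜 T s)

variable {𝕜}

/-- Operators of finite rank. -/
def IsFiniteRank (K : E →L[𝕜] E) : Prop :=
  FiniteDimensional 𝕜 (LinearMap.range (K : E →ₗ[𝕜] E))

/-- `A` and `B` are invertible, and `A B⁻¹` is of the form `Id + finite rank`. In this case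
`A B⁻¹` has a (non-zero) Fredholm determinant. -/
def IsDetRatio (A B : E →L[𝕜] E) : Prop :=
  IsUnit A ∧ IsUnit B ∧ IsFiniteRank (A * Ring.inverse B - 1)

variable (𝕜)

/-- `det_F (A B⁻¹)`. -/
def detRatio (A B : E →L[𝕜] E) : 𝕜 := detF 𝕜 (A * Ring.inverse B)

/-- The transition function `g_{A,B}(T) = det_F ((T + A) (T + B)⁻¹)` of the determinant line
bundle, at an operator `T` such that `T + A` and `T + B` are invertible. -/
def transition (A B T : E →L[𝕜] E) : 𝕜 := detRatio 𝕜 (T + A) (T + B)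

end FredholmDeterminant

/-! ### Symplectic Hilbert spaces and Lagrangian subspaces -/

variable {H : Type*} [NormedAddCommGroup H] [InnerProductSpace ℝ H]

variable (H) in
/-- An orthogonal almost complex structure `J` on the real Hilbert space `H`; it makes `H` a
symplectic Hilbert space with the symplectic form `ω(x, y) = ⟪J x, y⟫`. -/
structure ComplexStructure where
  toCLM : H →L[ℝ] H
  sq : ∀ x, toCLM (toCLM x) = -x
  inner_map : ∀ x y, ⟪toCLM x, toCLM y⟫ = ⟪x, y⟫

/-- The symplectic form. -/
def ComplexStructure.form (J : ComplexStructure H) (x y : H) : ℝ := ⟪J.toCLM x, y⟫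

/-- Lagrangian subspaces: subspaces that are equal to their annihilator with respect to the
symplectic form. -/
structure Lagrangian (J : ComplexStructure H) where
  carrier : Submodule ℝ H
  mem_iff : ∀ x, x ∈ carrier ↔ ∀ y ∈ carrier, J.form x y = 0

variable {J : ComplexStructure H}

theorem Lagrangian.mem_iff_map_mem_orthogonal (l : Lagrangian J) (x : H) :
    x ∈ l.carrier ↔ J.toCLM x ∈ l.carrierᗮ := by
  rw [l.mem_iff, Submodule.mem_orthogonal']
  rfl

theorem Lagrangian.isClosed (l : Lagrangian J) : IsClosed (l.carrier : Set H) := by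
  have : (l.carrier : Set H) = J.toCLM ⁻¹' (l.carrierᗮ : Set H) := by
    ext x
    exact l.mem_iff_map_mem_orthogonal x
  rw [this]
  exact (Submodule.isClosed_orthogonal _).preimage J.toCLM.continuous

instance [CompleteSpace H] (l : Lagrangian J) : l.carrier.HasOrthogonalProjection :=
  haveI : CompleteSpace l.carrier := l.isClosed.completeSpace_coe
  inferInstance

/-- `l` and `m` almost coincide: `dim l/(l ∩ m) = dim m/(l ∩ m) < ∞`. -/
def AlmostCoincide (l m : Lagrangian J) : Prop :=
  FiniteDimensional ℝ (l.carrier ⧸ (l.carrier ⊓ m.carrier).submoduleOf l.carrier) ∧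
  FiniteDimensional ℝ (m.carrier ⧸ (l.carrier ⊓ m.carrier).submoduleOf m.carrier) ∧
  Module.finrank ℝ (l.carrier ⧸ (l.carrier ⊓ m.carrier).submoduleOf l.carrier) =
    Module.finrank ℝ (m.carrier ⧸ (l.carrier ⊓ m.carrier).submoduleOf m.carrier)

/-- The Fredholm Lagrangian Grassmannian of `l`: the Lagrangian subspaces `m` with `l ∩ m` finite
dimensional and `l + m` closed and of finite codimension. -/
def FredholmLagrangian (l : Lagrangian J) : Set (Lagrangian J) :=
  {m | FiniteDimensional ℝ ↥(l.carrier ⊓ m.carrier) ∧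
    IsClosed ((l.carrier ⊔ m.carrier : Submodule ℝ H) : Set H) ∧
    FiniteDimensional ℝ (H ⧸ (l.carrier ⊔ m.carrier))}

/-- The open subset of those `m` in the Fredholm Lagrangian Grassmannian of `l` that are
transversal to `l`. -/
def FredholmLagrangian₀ (l : Lagrangian J) : Set (Lagrangian J) :=
  {m | m ∈ FredholmLagrangian l ∧ m.carrier ⊓ l.carrier = ⊥}

section Projections

variable [CompleteSpace H]

/-- The orthogonal projection onto `l`. -/
def P (l : Lagrangian J) : H →L[ℝ] H := l.carrier.starProjection

/-- The orthogonal projection onto the orthogonal complement of `l`. -/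
def Pperp (l : Lagrangian J) : H →L[ℝ] H := l.carrierᗮ.starProjection

/-- The complex conjugation `τ_l = 2 P(l) - Id`, that is `x + J y ↦ x - J y` for `x, y ∈ l`. -/
def tau (l : Lagrangian J) : H →L[ℝ] H := (2 : ℝ) • P l - 1

/-- `p_l(m) = P(mᗮ) + P(lᗮ)`. -/
def p (l m : Lagrangian J) : H →L[ℝ] H := Pperp m + Pperp l

/-- `q_l(m) = Id - τ_m τ_l`, as a real linear operator on `H`. -/
def qReal (l m : Lagrangian J) : H →L[ℝ] H := 1 - tau m * tau l

/-- The perturbation `P(tᗮ) - P(lᗮ)` that gives the trivialization along `p_l` over the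
Lagrangians transversal to `t`. -/
def pPert (l t : Lagrangian J) : H →L[ℝ] H := Pperp t - Pperp l

/-- The perturbation `-Id + τ_t τ_l` that gives the trivialization along `q_l` over the
Lagrangians transversal to `t`, as a real linear operator on `H`. -/
def qRealPert (l t : Lagrangian J) : H →L[ℝ] H := -1 + tau t * tau l

theorem P_map (l : Lagrangian J) (x : H) : P l (J.toCLM x) = J.toCLM (x - P l x) := by
  have h1 : P l x ∈ l.carrier := Submodule.starProjection_apply_mem _ _
  have h2 : x - P l x ∈ l.carrierᗮ := Submodule.sub_starProjection_mem_orthogonal x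
  refine Submodule.eq_starProjection_of_mem_orthogonal ?_ ?_
  · rw [l.mem_iff_map_mem_orthogonal, J.sq]
    exact Submodule.neg_mem _ h2
  · rw [← map_sub, sub_sub_cancel]
    exact (l.mem_iff_map_mem_orthogonal _).1 h1

/-- The conjugation `τ_l` is antilinear. -/
theorem tau_map (l : Lagrangian J) (x : H) : tau l (J.toCLM x) = -J.toCLM (tau l x) := by
  change (2 : ℝ) • P l (J.toCLM x) - J.toCLM x = -J.toCLM ((2 : ℝ) • P l x - x)
  simp only [P_map, map_sub, map_smul]
  module

end Projections

/-! ### The complex Hilbert space `H_J` -/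

/-- The space `H`, regarded as a complex Hilbert space by means of `J`. -/
def HJ (_J : ComplexStructure H) : Type _ := H

namespace HJ

instance : NormedAddCommGroup (HJ J) := inferInstanceAs (NormedAddCommGroup H)

instance [CompleteSpace H] : CompleteSpace (HJ J) := inferInstanceAs (CompleteSpace H)

/-- The identity map from `H` to `H_J`. -/
def of (J : ComplexStructure H) : H ≃+ HJ J := AddEquiv.refl H

/-- `(a + b i) x = a x + b J x`. -/
instance : SMul ℂ (HJ J) :=
  ⟨fun z x => of J (z.re • (of J).symm x + z.im • J.toCLM ((of J).symm x))⟩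

theorem smul_def (z : ℂ) (x : HJ J) :
    z • x = of J (z.re • (of J).symm x + z.im • J.toCLM ((of J).symm x)) := rfl

instance : Module ℂ (HJ J) where
  one_smul x := by simp [smul_def]
  mul_smul z w x := by
    obtain ⟨x, rfl⟩ := (of J).surjective x
    simp only [smul_def, AddEquiv.symm_apply_apply, Complex.mul_re, Complex.mul_im]
    congr 1
    simp only [map_add, map_smul, J.sq]
    module
  smul_zero z := by simp [smul_def]
  smul_add z x y := by
    simp only [smul_def, map_add, smul_add]
    abel
  add_smul z w x := by
    simp only [smul_def, Complex.add_re, Complex.add_im, add_smul, map_add]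
    abel
  zero_smul x := by simp [smul_def]

/-- The Hermitian inner product with real part `⟪x, y⟫` and imaginary part `⟪J x, y⟫`; it is
conjugate linear in the first variable, so that `inner ℂ y x = ⟪x, y⟫ - i ⟪J x, y⟫`. -/
instance : Inner ℂ (HJ J) :=
  ⟨fun x y => ⟨⟪(of J).symm x, (of J).symm y⟫, ⟪J.toCLM ((of J).symm x), (of J).symm y⟫⟩⟩

theorem inner_def (x y : HJ J) : inner ℂ x y =
    (⟨⟪(of J).symm x, (of J).symm y⟫, ⟪J.toCLM ((of J).symm x), (of J).symm y⟫⟩ : ℂ) := rfl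

theorem inner_map_left (J : ComplexStructure H) (x y : H) : ⟪J.toCLM x, y⟫ = -⟪x, J.toCLM y⟫ := by
  rw [← J.inner_map, J.sq, inner_neg_left]

theorem inner_map_self (J : ComplexStructure H) (x : H) : ⟪J.toCLM x, x⟫ = 0 := by
  have h := inner_map_left J x x
  rw [real_inner_comm (J.toCLM x) x] at h
  linarith

instance : NormedSpace ℂ (HJ J) where
  norm_smul_le z x := by
    obtain ⟨x, rfl⟩ := (of J).surjective x
    change ‖z.re • x + z.im • J.toCLM x‖ ≤ ‖z‖ * ‖x‖
    have hJ : ‖J.toCLM x‖ * ‖J.toCLM x‖ = ‖x‖ * ‖x‖ := by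
      rw [← real_inner_self_eq_norm_mul_norm, ← real_inner_self_eq_norm_mul_norm, J.inner_map]
    have h0 : ⟪z.re • x, z.im • J.toCLM x⟫ = 0 := by
      rw [inner_smul_left, inner_smul_right, real_inner_comm, inner_map_self]
      simp
    have h1 := norm_add_sq_eq_norm_sq_add_norm_sq_of_inner_eq_zero _ _ h0
    have h2 : ‖z‖ * ‖z‖ = z.re * z.re + z.im * z.im := by
      rw [Complex.norm_mul_self_eq_normSq, Complex.normSq_apply]
    rw [norm_smul, norm_smul, Real.norm_eq_abs, Real.norm_eq_abs] at h1
    refine le_of_sq_le_sq ?_ (by positivity)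
    have h3 := abs_mul_abs_self z.re
    have h4 := abs_mul_abs_self z.im
    calc _ = ‖z.re • x + z.im • J.toCLM x‖ * ‖z.re • x + z.im • J.toCLM x‖ := by ring
      _ = (|z.re| * |z.re|) * (‖x‖ * ‖x‖) + (|z.im| * |z.im|) * (‖J.toCLM x‖ * ‖J.toCLM x‖) := by
        rw [h1]; ring
      _ = (‖z‖ * ‖z‖) * (‖x‖ * ‖x‖) := by rw [h3, h4, hJ, h2]; ring
      _ = (‖z‖ * ‖x‖) ^ 2 := by ring
      _ ≤ _ := le_rfl

instance : InnerProductSpace ℂ (HJ J) where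
  norm_sq_eq_re_inner x := (real_inner_self_eq_norm_sq (F := H) ((of J).symm x)).symm
  conj_inner_symm x y := by
    apply Complex.ext
    · exact real_inner_comm _ _
    · simp only [inner_def, Complex.conj_im]
      rw [inner_map_left, neg_neg, real_inner_comm]
  add_left x y z := by
    apply Complex.ext <;> simp [inner_def, inner_add_left]
  smul_left x y z := by
    apply Complex.ext
    · simp [inner_def, smul_def, inner_add_left, inner_smul_left]
    · simp [inner_def, smul_def, inner_add_left, inner_smul_left, J.sq]

end HJ

section Complex

variable [CompleteSpace H]

/-- The complex linear operator `τ_m τ_l` on `H_J`. -/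
def tauTau (m l : Lagrangian J) : HJ J →L[ℂ] HJ J where
  toFun x := HJ.of J (tau m (tau l ((HJ.of J).symm x)))
  map_add' x y := by simp
  map_smul' z x := by
    simp only [HJ.smul_def, AddEquiv.symm_apply_apply, map_add, map_smul, tau_map, map_neg,
      neg_neg, RingHom.id_apply]
  cont := ((tau m).continuous.comp (tau l).continuous :)

/-- `q_l(m) = Id - τ_m τ_l`, as a complex linear operator on `H_J`. -/
def q (l m : Lagrangian J) : HJ J →L[ℂ] HJ J := 1 - tauTau m l

/-- The perturbation `-Id + τ_t τ_l`, as a complex linear operator on `H_J`. -/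
def qPert (l t : Lagrangian J) : HJ J →L[ℂ] HJ J := -1 + tauTau t l

end Complex

end QuillenDet

end

namespace QuillenDet

/-! ### Fredholm determinants of finite rank perturbations of the identity -/

section FredholmDeterminant

variable {𝕜 : Type*} [RCLike 𝕜] {E : Type*} [NormedAddCommGroup E] [InnerProductSpace 𝕜 E]

/-! Transversality and closedness of `θ + μ` make `θ` and `μ` complementary: the orthogonal
complement of the sum is carried by `J` into `θ ∩ μ = 0`. Then `x ↦ (P θ x, P μ x)` is a bijection
of `H` onto `θ × μ`, so `P θ ∓ P μ` are invertible, and `P θ + P μ = R (P θ - P μ)` with `R` the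
reflection in `θ` along `μ`. Let `R'` be the reflection for `θ'` and `T` the ratio of the
differences. The ratio of the sums is `R T R' = (R T R)(R R')`. The first factor is conjugate to
`T`; the second is unipotent, because `R R' - 1` maps into `μ` and kills `μ`, so it has determinant
1 (`detRatio_P_add_P`).

The orthogonal complements bring only a sign, or conjugation by `J`. Along `q` the perturbed
operator is `(P t - P μ)(2 τ_l)`, whose right factor cancels in the ratio (`qReal_add_qRealPert`);
along `p` it is `Pperp t + Pperp μ`. The complex statement is `det_ℝ = |det_ℂ|²`
(`detF_real_eq_norm_sq`). All determinant computations reduce to finite dimensions by `detF_eq_det`.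
-/

theorem det_one_add_comp_comm {K V W : Type*} [Field K] [AddCommGroup V] [Module K V]
    [AddCommGroup W] [Module K W] [FiniteDimensional K V] [FiniteDimensional K W]
    (A : V →ₗ[K] W) (B : W →ₗ[K] V) :
    LinearMap.det (1 + A ∘ₗ B) = LinearMap.det (1 + B ∘ₗ A) := by
  classical
  let b := Module.finBasis K V
  let c := Module.finBasis K W
  rw [← LinearMap.det_toMatrix c, ← LinearMap.det_toMatrix b, map_add, map_add,
    LinearMap.toMatrix_one, LinearMap.toMatrix_one, LinearMap.toMatrix_comp c b c,
    LinearMap.toMatrix_comp b c b, Matrix.det_one_add_mul_comm]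

/-- If `T = Id + A B` with `A` and `B` factoring through a finite dimensional space, then the
Fredholm determinant of `T` is the determinant of `Id + B A`. -/
theorem detF_eq_det {V : Type*} [AddCommGroup V] [Module 𝕜 V] [FiniteDimensional 𝕜 V]
    {T : E →L[𝕜] E} (A : V →ₗ[𝕜] E) (B : E →ₗ[𝕜] V) (h : ∀ x, T x = x + A (B x)) :
    detF 𝕜 T = LinearMap.det (1 + B ∘ₗ A) := by
  classical
  obtain ⟨s₀, hs₀⟩ : (LinearMap.range A).FG := Module.Finite.iff_fg.1 inferInstance
  -- The net is eventually constant: once the span contains the range of `A`, it is invariant under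
  -- `T` and the projection in the compression does nothing.
  refine Filter.Tendsto.limUnder_eq (tendsto_const_nhds.congr' ?_)
  filter_upwards [eventually_ge_atTop s₀] with s hs
  have hle : ∀ v, A v ∈ Submodule.span 𝕜 (s : Set E) := fun v =>
    Submodule.span_mono (Finset.coe_subset.2 hs) (hs₀ ▸ LinearMap.mem_range_self A v)
  have hc : compression 𝕜 T s =
      1 + A.codRestrict _ hle ∘ₗ B ∘ₗ (Submodule.span 𝕜 (s : Set E)).subtype := by
    ext x
    have hx : T x = ((x + A.codRestrict _ hle (B x) : Submodule.span 𝕜 (s : Set E)) : E) := h x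
    change (((Submodule.span 𝕜 (s : Set E)).orthogonalProjectionOnto (T x) : _) : E) = _
    rw [hx, Submodule.orthogonalProjectionOnto_mem_subspace_eq_self]
    rfl
  rw [hc, det_one_add_comp_comm (W := Submodule.span 𝕜 (s : Set E))]
  rfl

namespace IsFiniteRank

theorem of_forall_mem {K : E →L[𝕜] E} (V : Submodule 𝕜 E) [FiniteDimensional 𝕜 V]
    (h : ∀ x, K x ∈ V) : IsFiniteRank K :=
  Submodule.finiteDimensional_of_le (S₂ := V) (by rintro _ ⟨x, rfl⟩; exact h x)

theorem add {K L : E →L[𝕜] E} (hK : IsFiniteRank K) (hL : IsFiniteRank L) :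
    IsFiniteRank (K + L) := by
  unfold IsFiniteRank at hK hL
  exact of_forall_mem (LinearMap.range (K : E →ₗ[𝕜] E) ⊔ LinearMap.range (L : E →ₗ[𝕜] E))
    fun x => Submodule.add_mem_sup ⟨x, rfl⟩ ⟨x, rfl⟩

theorem mul_right {K : E →L[𝕜] E} (hK : IsFiniteRank K) (L : E →L[𝕜] E) :
    IsFiniteRank (K * L) := by
  unfold IsFiniteRank at hK
  exact of_forall_mem (LinearMap.range (K : E →ₗ[𝕜] E)) fun x => ⟨L x, rfl⟩

theorem mul_left {K : E →L[𝕜] E} (hK : IsFiniteRank K) (L : E →L[𝕜] E) :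
    IsFiniteRank (L * K) := by
  unfold IsFiniteRank at hK
  exact of_forall_mem ((LinearMap.range (K : E →ₗ[𝕜] E)).map (L : E →ₗ[𝕜] E))
    fun x => ⟨K x, ⟨x, rfl⟩, rfl⟩

theorem neg {K : E →L[𝕜] E} (hK : IsFiniteRank K) : IsFiniteRank (-K) := by
  simpa using hK.mul_left (-1)

/-- An operator that vanishes on a subspace with a finite dimensional supplement has finite
rank. -/
theorem of_ker {K : E →L[𝕜] E} (C F : Submodule 𝕜 E) [FiniteDimensional 𝕜 F] (h : C ⊔ F = ⊤)
    (hC : ∀ x ∈ C, K x = 0) : IsFiniteRank K := by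
  refine of_forall_mem (F.map (K : E →ₗ[𝕜] E)) fun x => ?_
  obtain ⟨c, hc, f, hf, rfl⟩ := Submodule.mem_sup.1 (h ▸ Submodule.mem_top (x := x))
  exact ⟨f, hf, by simp [hC c hc]⟩

end IsFiniteRank

/-- If `T - 1 = A B` through its range, the conjugate is `1 + (G A)(B G')`, and `B G' G A = B A`. -/
theorem detF_conj {T G G' : E →L[𝕜] E} (hT : IsFiniteRank (T - 1)) (h : G * G' = 1)
    (h' : G' * G = 1) : detF 𝕜 (G * T * G') = detF 𝕜 T := by
  unfold IsFiniteRank at hT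
  let B := ((T - 1 : E →L[𝕜] E) : E →ₗ[𝕜] E).rangeRestrict
  let A := (LinearMap.range ((T - 1 : E →L[𝕜] E) : E →ₗ[𝕜] E)).subtype
  have hAB : ∀ x, T x = x + A (B x) := fun x => (add_sub_cancel x (T x)).symm
  have h1 : ∀ x, G (G' x) = x := fun x => congr($h x)
  have h2 : ∀ x, G' (G x) = x := fun x => congr($h' x)
  rw [detF_eq_det A B hAB, detF_eq_det ((G : E →ₗ[𝕜] E) ∘ₗ A) (B ∘ₗ (G' : E →ₗ[𝕜] E))]
  · congr 2
    ext x
    change ((B (G' (G (A x))) : _) : E) = (B (A x) : _)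
    rw [h2]
  · intro x
    change G (T (G' x)) = x + G (A (B (G' x)))
    rw [hAB, map_add, h1]

/-- Both perturbations take values in the sum `V` of their ranges, so multiplicativity is that of
the determinant on `V`. -/
theorem detF_mul {S T : E →L[𝕜] E} (hS : IsFiniteRank (S - 1)) (hT : IsFiniteRank (T - 1)) :
    detF 𝕜 (S * T) = detF 𝕜 S * detF 𝕜 T := by
  unfold IsFiniteRank at hS hT
  let V := LinearMap.range ((S - 1 : E →L[𝕜] E) : E →ₗ[𝕜] E) ⊔
    LinearMap.range ((T - 1 : E →L[𝕜] E) : E →ₗ[𝕜] E)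
  let BS : E →ₗ[𝕜] V := ((S - 1 : E →L[𝕜] E) : E →ₗ[𝕜] E).codRestrict V
    fun x => Submodule.mem_sup_left ⟨x, rfl⟩
  let BT : E →ₗ[𝕜] V := ((T - 1 : E →L[𝕜] E) : E →ₗ[𝕜] E).codRestrict V
    fun x => Submodule.mem_sup_right ⟨x, rfl⟩
  have hS' : ∀ x, S x = x + V.subtype (BS x) := fun x => by simp [BS]
  have hT' : ∀ x, T x = x + V.subtype (BT x) := fun x => by simp [BT]
  rw [detF_eq_det _ _ hS', detF_eq_det _ _ hT', ← LinearMap.det_comp,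
    detF_eq_det V.subtype (BS + BT + BS ∘ₗ V.subtype ∘ₗ BT)]
  · congr 1
    ext x
    simp
    abel
  · intro x
    change S (T x) = _
    rw [hT' x, map_add, hS', hS' (V.subtype _)]
    simp
    abel

/-- `T - 1` vanishes on its own range, so the finite dimensional determinant is that of the
identity. -/
theorem detF_eq_one {T : E →L[𝕜] E} (hT : IsFiniteRank (T - 1))
    (h : (T - 1) * (T - 1) = 0) : detF 𝕜 T = 1 := by
  unfold IsFiniteRank at hT
  let B := ((T - 1 : E →L[𝕜] E) : E →ₗ[𝕜] E).rangeRestrict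
  let A := (LinearMap.range ((T - 1 : E →L[𝕜] E) : E →ₗ[𝕜] E)).subtype
  have hAB : ∀ x, T x = x + A (B x) := fun x => (add_sub_cancel x (T x)).symm
  have hBA : B ∘ₗ A = 0 := by
    ext ⟨_, x, rfl⟩
    exact congr($h x)
  rw [detF_eq_det A B hAB, hBA, add_zero, map_one]

theorem IsDetRatio.of_sub {A B : E →L[𝕜] E} (hA : IsUnit A) (hB : IsUnit B)
    (h : IsFiniteRank (A - B)) : IsDetRatio A B := by
  refine ⟨hA, hB, ?_⟩
  have := h.mul_right (Ring.inverse B)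
  rwa [sub_mul, Ring.mul_inverse_cancel B hB] at this

/-! ### Comparison of real and complex determinants -/

/-- The identity map from `H` to `H_J`, as a real linear map. -/
def HJ.realLinearEquiv {H : Type*} [NormedAddCommGroup H] [InnerProductSpace ℝ H]
    (J : ComplexStructure H) : H ≃ₗ[ℝ] HJ J :=
  { HJ.of J with
    map_smul' := fun r x => by
      change HJ.of J (r • x) = HJ.of J (r • x + (0 : ℝ) • J.toCLM x)
      rw [zero_smul, add_zero] }

theorem IsFiniteRank.complex {H : Type*} [NormedAddCommGroup H] [InnerProductSpace ℝ H]
    {J : ComplexStructure H} {S : H →L[ℝ] H} {T : HJ J →L[ℂ] HJ J}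
    (h : ∀ x, T (HJ.of J x) = HJ.of J (S x)) (hS : IsFiniteRank S) : IsFiniteRank T := by
  unfold IsFiniteRank at hS
  let V := (LinearMap.range (S : H →ₗ[ℝ] H)).map (HJ.realLinearEquiv J : H →ₗ[ℝ] HJ J)
  have : FiniteDimensional ℝ
      ((LinearMap.range (T : HJ J →ₗ[ℂ] HJ J)).restrictScalars ℝ) := by
    refine Submodule.finiteDimensional_of_le (S₂ := V) ?_
    rintro _ ⟨x, rfl⟩
    exact ⟨S ((HJ.of J).symm x), ⟨_, rfl⟩, (h _).symm⟩
  exact Module.Finite.of_restrictScalars_finite ℝ ℂ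
    ((LinearMap.range (T : HJ J →ₗ[ℂ] HJ J)).restrictScalars ℝ)

/-- A complex linear operator on `H_J` and the same map as a real linear operator on `H`. -/
theorem detF_real_eq_norm_sq {H : Type*} [NormedAddCommGroup H] [InnerProductSpace ℝ H]
    {J : ComplexStructure H} {S : H →L[ℝ] H} {T : HJ J →L[ℂ] HJ J}
    (h : ∀ x, T (HJ.of J x) = HJ.of J (S x)) (hT : IsFiniteRank (T - 1)) :
    detF ℝ S = ‖detF ℂ T‖ ^ 2 := by
  unfold IsFiniteRank at hT
  let B := ((T - 1 : HJ J →L[ℂ] HJ J) : HJ J →ₗ[ℂ] HJ J).rangeRestrict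
  let A := (LinearMap.range ((T - 1 : HJ J →L[ℂ] HJ J) : HJ J →ₗ[ℂ] HJ J)).subtype
  have hAB : ∀ x, T x = x + A (B x) := fun x => (add_sub_cancel x (T x)).symm
  let e := HJ.realLinearEquiv J
  -- Both determinants live on the range of `T - 1`, a finite dimensional complex space; there the
  -- real determinant is the norm from `ℂ` to `ℝ` of the complex one.
  rw [detF_eq_det A B hAB, detF_eq_det ((e.symm : HJ J →ₗ[ℝ] H) ∘ₗ A.restrictScalars ℝ)
    (B.restrictScalars ℝ ∘ₗ (e : H →ₗ[ℝ] HJ J)), ← Complex.normSq_eq_norm_sq,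
    ← Algebra.norm_complex_apply, ← LinearMap.det_restrictScalars]
  · congr 1
  · intro x
    have : e (S x) = e x + A (B (e x)) := (h x).symm.trans (hAB _)
    exact e.injective (this.trans (by
      rw [map_add]
      exact congrArg _ (e.apply_symm_apply _).symm))

end FredholmDeterminant

/-! ### Lagrangian subspaces and their projections -/

noncomputable section Lagrangian

variable {H : Type*} [NormedAddCommGroup H] [InnerProductSpace ℝ H] {J : ComplexStructure H}

theorem Lagrangian.map_mem_of_mem_orthogonal (l : Lagrangian J) {x : H} (hx : x ∈ l.carrierᗮ) :
    J.toCLM x ∈ l.carrier := by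
  rw [l.mem_iff_map_mem_orthogonal, J.sq]
  exact neg_mem hx

theorem Lagrangian.map_mem_orthogonal (l : Lagrangian J) {x : H} (hx : x ∈ l.carrier) :
    J.toCLM x ∈ l.carrierᗮ :=
  (l.mem_iff_map_mem_orthogonal x).1 hx

theorem ComplexStructure.mul_neg_self (J : ComplexStructure H) : J.toCLM * -J.toCLM = 1 := by
  ext x
  simp [J.sq]

theorem ComplexStructure.neg_self_mul (J : ComplexStructure H) : -J.toCLM * J.toCLM = 1 := by
  ext x
  simp [J.sq]

theorem ComplexStructure.isUnit_toCLM (J : ComplexStructure H) : IsUnit J.toCLM :=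
  ⟨⟨_, _, J.mul_neg_self, J.neg_self_mul⟩, rfl⟩

theorem neg_mul_inverse_neg {R : Type*} [Ring R] {A B : R} (hB : IsUnit B) :
    -A * Ring.inverse (-B) = A * Ring.inverse B := by
  symm
  rw [Ring.eq_mul_inverse_iff_mul_eq _ _ _ hB.neg, mul_neg, Ring.inverse_mul_cancel_right _ _ hB]

theorem eq_zero_of_mem_of_mem {θ μ : Submodule ℝ H} (h : IsCompl θ μ) {x : H} (h1 : x ∈ θ)
    (h2 : x ∈ μ) : x = 0 :=
  (Submodule.mem_bot ℝ).1 (h.inf_eq_bot ▸ ⟨h1, h2⟩)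

theorem exists_finiteDimensional_sup_eq {l : Submodule ℝ H} (C : Submodule ℝ H) (hC : C ≤ l)
    (h : FiniteDimensional ℝ (l ⧸ C.submoduleOf l)) :
    ∃ F : Submodule ℝ H, FiniteDimensional ℝ F ∧ C ⊔ F = l := by
  obtain ⟨F, hF⟩ := Submodule.exists_isCompl (C.submoduleOf l)
  have : FiniteDimensional ℝ F :=
    (Submodule.quotientEquivOfIsCompl _ _ hF).finiteDimensional
  refine ⟨F.map l.subtype, inferInstance, ?_⟩
  have h1 := congr(Submodule.map l.subtype $hF.sup_eq_top)
  rwa [Submodule.map_sup, Submodule.submoduleOf, Submodule.map_comap_subtype,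
    inf_eq_right.2 hC, Submodule.map_top, Submodule.range_subtype] at h1

variable [CompleteSpace H]

/-- A closed sum is everything once its orthogonal complement is zero, and `J` embeds that
complement in `θ ∩ μ`. -/
theorem isCompl_of_mem {θ μ : Lagrangian J} (h : μ ∈ FredholmLagrangian₀ θ) :
    IsCompl θ.carrier μ.carrier := by
  obtain ⟨⟨-, hc, -⟩, h0⟩ := h
  rw [inf_comm] at h0
  refine ⟨disjoint_iff.2 h0, codisjoint_iff.2 ?_⟩
  have : CompleteSpace ↥(θ.carrier ⊔ μ.carrier) := hc.completeSpace_coe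
  rw [← Submodule.orthogonal_eq_bot_iff, ← Submodule.inf_orthogonal, eq_bot_iff]
  rintro x ⟨h1, h2⟩
  have hx : J.toCLM x ∈ θ.carrier ⊓ μ.carrier :=
    ⟨θ.map_mem_of_mem_orthogonal h1, μ.map_mem_of_mem_orthogonal h2⟩
  rw [h0, Submodule.mem_bot] at hx
  rw [Submodule.mem_bot, ← neg_eq_zero, ← J.sq, hx, map_zero]

theorem P_mem (l : Lagrangian J) (x : H) : P l x ∈ l.carrier :=
  Submodule.starProjection_apply_mem _ _

theorem P_eq_self {l : Lagrangian J} {x : H} (hx : x ∈ l.carrier) : P l x = x :=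
  Submodule.starProjection_eq_self_iff.2 hx

theorem P_eq_zero {l : Lagrangian J} {x : H} (hx : x ∈ l.carrierᗮ) : P l x = 0 :=
  (Submodule.starProjection_apply_eq_zero_iff _).2 hx

theorem Pperp_eq (l : Lagrangian J) : Pperp l = 1 - P l :=
  Submodule.starProjection_orthogonal' _

theorem tau_mul_tau (l : Lagrangian J) : tau l * tau l = 1 := by
  ext x
  change (2 : ℝ) • P l ((2 : ℝ) • P l x - x) - ((2 : ℝ) • P l x - x) = x
  rw [map_sub, map_smul, P_eq_self (P_mem l x)]
  module

/-! ### Transversal pairs and reflections -/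

section Transversal

variable {θ θ' μ : Lagrangian J}

theorem exists_P_eq (h : IsCompl θ.carrier μ.carrier) {a b : H} (ha : a ∈ θ.carrier)
    (hb : b ∈ μ.carrier) : ∃ x, P θ x = a ∧ P μ x = b := by
  -- The solution must lie in `(a + J θ) ∩ (b + J μ)`, since `J θ` and `J μ` are killed by the
  -- respective projections; this means splitting `b - a` along `J θ + J μ`.
  obtain ⟨u, hu, v, hv, huv⟩ := Submodule.mem_sup.1
    (h.sup_eq_top ▸ Submodule.mem_top (x := -J.toCLM (b - a)))
  have h1 := θ.map_mem_orthogonal hu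
  have h2 := μ.map_mem_orthogonal hv
  have h3 : J.toCLM u + J.toCLM v = b - a := by rw [← map_add, huv, map_neg, J.sq, neg_neg]
  refine ⟨a + J.toCLM u, ?_, ?_⟩
  · rw [map_add, P_eq_self ha, P_eq_zero h1, add_zero]
  · rw [show a + J.toCLM u = b - J.toCLM v by rw [eq_sub_iff_add_eq, add_assoc, h3]; abel,
      map_sub, P_eq_self hb, P_eq_zero h2, sub_zero]

theorem eq_zero_of_P_eq_zero (h : IsCompl θ.carrier μ.carrier) {x : H} (h1 : P θ x = 0)
    (h2 : P μ x = 0) : x = 0 := by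
  have hx : J.toCLM x ∈ θ.carrier ⊓ μ.carrier :=
    ⟨θ.map_mem_of_mem_orthogonal ((Submodule.starProjection_apply_eq_zero_iff _).1 h1),
      μ.map_mem_of_mem_orthogonal ((Submodule.starProjection_apply_eq_zero_iff _).1 h2)⟩
  rw [h.inf_eq_bot, Submodule.mem_bot] at hx
  rw [← neg_eq_zero, ← J.sq, hx, map_zero]

theorem isUnit_P_sub_P (h : IsCompl θ.carrier μ.carrier) : IsUnit (P θ - P μ) := by
  refine ContinuousLinearMap.isUnit_iff_bijective.2 ⟨?_, fun y => ?_⟩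
  · refine (injective_iff_map_eq_zero _).2 fun x hx => ?_
    have hx : P θ x = P μ x := sub_eq_zero.1 hx
    have h0 := eq_zero_of_mem_of_mem h (P_mem θ x) (hx ▸ P_mem μ x)
    exact eq_zero_of_P_eq_zero h h0 (hx ▸ h0)
  · obtain ⟨a, ha, b, hb, rfl⟩ := Submodule.mem_sup.1 (h.sup_eq_top ▸ Submodule.mem_top (x := y))
    obtain ⟨x, h1, h2⟩ := exists_P_eq h ha (neg_mem hb)
    exact ⟨x, by simp [h1, h2]⟩

theorem isUnit_P_add_P (h : IsCompl θ.carrier μ.carrier) : IsUnit (P θ + P μ) := by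
  refine ContinuousLinearMap.isUnit_iff_bijective.2 ⟨?_, fun y => ?_⟩
  · refine (injective_iff_map_eq_zero _).2 fun x hx => ?_
    have hx : P θ x = -P μ x := eq_neg_of_add_eq_zero_left hx
    have h0 := eq_zero_of_mem_of_mem h (P_mem θ x) (hx ▸ neg_mem (P_mem μ x))
    exact eq_zero_of_P_eq_zero h h0 (neg_eq_zero.1 (hx ▸ h0))
  · obtain ⟨a, ha, b, hb, rfl⟩ := Submodule.mem_sup.1 (h.sup_eq_top ▸ Submodule.mem_top (x := y))
    obtain ⟨x, h1, h2⟩ := exists_P_eq h ha hb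
    exact ⟨x, by simp [h1, h2]⟩

/-- The reflection in `θ` along `μ`. -/
def reflection (θ μ : Lagrangian J) : H →L[ℝ] H := (P θ + P μ) * Ring.inverse (P θ - P μ)

theorem reflection_mul (h : IsCompl θ.carrier μ.carrier) :
    reflection θ μ * (P θ - P μ) = P θ + P μ :=
  Ring.inverse_mul_cancel_right _ _ (isUnit_P_sub_P h)

theorem reflection_apply_left (h : IsCompl θ.carrier μ.carrier) {a : H} (ha : a ∈ θ.carrier) :
    reflection θ μ a = a := by
  obtain ⟨x, h1, h2⟩ := exists_P_eq h ha (zero_mem _)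
  have := congr($(reflection_mul h) x)
  simpa [h1, h2] using this

theorem reflection_apply_right (h : IsCompl θ.carrier μ.carrier) {b : H} (hb : b ∈ μ.carrier) :
    reflection θ μ b = -b := by
  obtain ⟨x, h1, h2⟩ := exists_P_eq h (zero_mem _) (neg_mem hb)
  have := congr($(reflection_mul h) x)
  simpa [h1, h2] using this

theorem reflection_mul_self (h : IsCompl θ.carrier μ.carrier) :
    reflection θ μ * reflection θ μ = 1 := by
  ext y
  obtain ⟨a, ha, b, hb, rfl⟩ := Submodule.mem_sup.1 (h.sup_eq_top ▸ Submodule.mem_top (x := y))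
  simp [reflection_apply_left h ha, reflection_apply_right h hb]

/-- The two reflections agree on `(θ ∩ θ') + μ`, which has finite codimension. -/
theorem isFiniteRank_reflection_sub (hθ : AlmostCoincide θ θ')
    (h : IsCompl θ.carrier μ.carrier) (h' : IsCompl θ'.carrier μ.carrier) :
    IsFiniteRank (reflection θ μ - reflection θ' μ) := by
  obtain ⟨F, hF, hC⟩ := exists_finiteDimensional_sup_eq _ inf_le_left hθ.1
  refine IsFiniteRank.of_ker (θ.carrier ⊓ θ'.carrier ⊔ μ.carrier) F ?_ fun x hx => ?_
  · rw [sup_right_comm, hC, h.sup_eq_top]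
  · obtain ⟨a, ha, b, hb, rfl⟩ := Submodule.mem_sup.1 hx
    simp [reflection_apply_left h ha.1, reflection_apply_right h hb,
      reflection_apply_left h' ha.2, reflection_apply_right h' hb]

/-- Each reflection is `-1` on `μ` and induces the identity on `H / μ`, so the product induces the
identity on both. -/
theorem reflection_mul_reflection_sub_one (h : IsCompl θ.carrier μ.carrier)
    (h' : IsCompl θ'.carrier μ.carrier) (x : H) :
    (reflection θ μ * reflection θ' μ - 1) x ∈ μ.carrier ∧
      (x ∈ μ.carrier → (reflection θ μ * reflection θ' μ - 1) x = 0) := by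
  have hb : ∀ b ∈ μ.carrier, (reflection θ μ * reflection θ' μ - 1) b = 0 := fun b hb => by
    simp [reflection_apply_right h' hb, reflection_apply_right h hb]
  refine ⟨?_, hb x⟩
  obtain ⟨a, ha, b, hb', rfl⟩ := Submodule.mem_sup.1 (h'.sup_eq_top ▸ Submodule.mem_top (x := x))
  rw [map_add, hb b hb', add_zero]
  obtain ⟨c, hc, d, hd, rfl⟩ := Submodule.mem_sup.1 (h.sup_eq_top ▸ Submodule.mem_top (x := a))
  have : (reflection θ μ * reflection θ' μ - 1) (c + d) = -((2 : ℝ) • d) := by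
    change reflection θ μ (reflection θ' μ (c + d)) - (c + d) = _
    rw [reflection_apply_left h' ha, map_add, reflection_apply_left h hc,
      reflection_apply_right h hd]
    module
  rw [this]
  exact neg_mem (Submodule.smul_mem _ _ hd)

theorem isFiniteRank_reflection_mul_sub_one (hθ : AlmostCoincide θ θ')
    (h : IsCompl θ.carrier μ.carrier) (h' : IsCompl θ'.carrier μ.carrier) :
    IsFiniteRank (reflection θ μ * reflection θ' μ - 1) := by
  have := (isFiniteRank_reflection_sub hθ h h').mul_right (reflection θ' μ)
  rwa [sub_mul, reflection_mul_self h'] at this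

theorem detF_reflection_mul (hθ : AlmostCoincide θ θ') (h : IsCompl θ.carrier μ.carrier)
    (h' : IsCompl θ'.carrier μ.carrier) : detF ℝ (reflection θ μ * reflection θ' μ) = 1 := by
  refine detF_eq_one (isFiniteRank_reflection_mul_sub_one hθ h h') ?_
  ext x
  exact (reflection_mul_reflection_sub_one h h' _).2 (reflection_mul_reflection_sub_one h h' x).1

end Transversal

/-- With `C = θ ∩ θ'`, both projections are the identity on `C` and zero on `J C`; since `H = θ + J
θ`, the space `C + J C` has finite codimension. -/
theorem isFiniteRank_P_sub_P {θ θ' : Lagrangian J} (hθ : AlmostCoincide θ θ') :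
    IsFiniteRank (P θ - P θ') := by
  obtain ⟨F, hF, hC⟩ := exists_finiteDimensional_sup_eq _ inf_le_left hθ.1
  let C := θ.carrier ⊓ θ'.carrier
  let j : H →ₗ[ℝ] H := J.toCLM
  refine IsFiniteRank.of_ker (C ⊔ C.map j) (F ⊔ F.map j) ?_ fun x hx => ?_
  · rw [sup_sup_sup_comm, hC, ← Submodule.map_sup, hC, eq_top_iff]
    intro x _
    refine Submodule.mem_sup.2 ⟨P θ x, P_mem θ x, x - P θ x,
      ⟨-J.toCLM (x - P θ x), neg_mem (θ.map_mem_of_mem_orthogonal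
        (Submodule.sub_starProjection_mem_orthogonal x)), ?_⟩, add_sub_cancel _ _⟩
    change J.toCLM (-J.toCLM _) = _
    rw [map_neg, J.sq, neg_neg]
  · obtain ⟨a, ha, _, ⟨b, hb, rfl⟩, rfl⟩ := Submodule.mem_sup.1 hx
    change P θ (a + J.toCLM b) - P θ' (a + J.toCLM b) = 0
    rw [map_add, map_add, P_eq_self ha.1, P_eq_self ha.2, P_eq_zero (θ.map_mem_orthogonal hb.1),
      P_eq_zero (θ'.map_mem_orthogonal hb.2), sub_self]

theorem isFiniteRank_Pperp_sub_Pperp {θ θ' : Lagrangian J} (h : IsFiniteRank (P θ - P θ')) :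
    IsFiniteRank (Pperp θ - Pperp θ') := by
  have : Pperp θ - Pperp θ' = -(P θ - P θ') := by rw [Pperp_eq, Pperp_eq]; abel
  exact this ▸ h.neg

/-! ### The four determinant ratios -/

section Ratio

variable {θ θ' μ : Lagrangian J}

theorem isDetRatio_P_sub_P (hθ : AlmostCoincide θ θ') (h : IsCompl θ.carrier μ.carrier)
    (h' : IsCompl θ'.carrier μ.carrier) : IsDetRatio (P θ - P μ) (P θ' - P μ) :=
  .of_sub (isUnit_P_sub_P h) (isUnit_P_sub_P h') (by
    rw [sub_sub_sub_cancel_right]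
    exact isFiniteRank_P_sub_P hθ)

theorem isDetRatio_P_add_P (hθ : AlmostCoincide θ θ') (h : IsCompl θ.carrier μ.carrier)
    (h' : IsCompl θ'.carrier μ.carrier) : IsDetRatio (P θ + P μ) (P θ' + P μ) :=
  .of_sub (isUnit_P_add_P h) (isUnit_P_add_P h') (by
    rw [add_sub_add_right_eq_sub]
    exact isFiniteRank_P_sub_P hθ)

theorem detRatio_P_add_P (hθ : AlmostCoincide θ θ') (h : IsCompl θ.carrier μ.carrier)
    (h' : IsCompl θ'.carrier μ.carrier) :
    detRatio ℝ (P θ + P μ) (P θ' + P μ) = detRatio ℝ (P θ - P μ) (P θ' - P μ) := by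
  obtain ⟨-, hu', hr⟩ := isDetRatio_P_sub_P hθ h h'
  unfold detRatio
  set T := (P θ - P μ) * Ring.inverse (P θ' - P μ) with hT
  set R := reflection θ μ with hR
  have hRR : R * R = 1 := reflection_mul_self h
  have hTA : T * (P θ' - P μ) = P θ - P μ := Ring.inverse_mul_cancel_right _ _ hu'
  -- Inserting `R * R = 1` separates a conjugate of `T` from a unipotent factor.
  have h1 : (R * T * R) * (R * reflection θ' μ) =
      (P θ + P μ) * Ring.inverse (P θ' + P μ) := by
    rw [Ring.eq_mul_inverse_iff_mul_eq _ _ _ (isUnit_P_add_P h'), ← reflection_mul h,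
      ← reflection_mul h', ← hTA]
    calc _ = R * T * (R * R) * (reflection θ' μ * reflection θ' μ) * (P θ' - P μ) := by
          simp only [mul_assoc]
      _ = _ := by rw [hRR, reflection_mul_self h', mul_one, mul_one, mul_assoc]
  have h2 : IsFiniteRank (R * T * R - 1) := by
    have := (hr.mul_left R).mul_right R
    rwa [mul_sub, sub_mul, mul_one, hRR] at this
  rw [← h1, detF_mul h2 (isFiniteRank_reflection_mul_sub_one hθ h h'),
    detF_reflection_mul hθ h h', mul_one, detF_conj hr hRR hRR]

theorem Pperp_sub_Pperp (θ μ : Lagrangian J) : Pperp θ - Pperp μ = -(P θ - P μ) := by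
  rw [Pperp_eq, Pperp_eq]
  abel

/-- `J` interchanges a Lagrangian and its orthogonal complement, hence conjugates one projection
into the other. -/
theorem Pperp_add_Pperp (θ μ : Lagrangian J) :
    Pperp θ + Pperp μ = J.toCLM * (P θ + P μ) * -J.toCLM := by
  ext x
  simp only [Pperp_eq]
  change (x - P θ x) + (x - P μ x) = J.toCLM (P θ (-J.toCLM x) + P μ (-J.toCLM x))
  simp only [map_neg, P_map, map_add, J.sq]
  abel

theorem isUnit_Pperp_sub_Pperp (h : IsCompl θ.carrier μ.carrier) :
    IsUnit (Pperp θ - Pperp μ) := by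
  rw [Pperp_sub_Pperp]
  exact (isUnit_P_sub_P h).neg

theorem isUnit_Pperp_add_Pperp (h : IsCompl θ.carrier μ.carrier) :
    IsUnit (Pperp θ + Pperp μ) := by
  rw [Pperp_add_Pperp]
  exact ((J.isUnit_toCLM).mul (isUnit_P_add_P h)).mul (J.isUnit_toCLM).neg

theorem detRatio_Pperp_sub_Pperp (h' : IsCompl θ'.carrier μ.carrier) :
    detRatio ℝ (Pperp θ - Pperp μ) (Pperp θ' - Pperp μ) =
      detRatio ℝ (P θ - P μ) (P θ' - P μ) := by
  unfold detRatio
  rw [Pperp_sub_Pperp, Pperp_sub_Pperp, neg_mul_inverse_neg (isUnit_P_sub_P h')]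

theorem detRatio_Pperp_add_Pperp (hθ : AlmostCoincide θ θ') (h : IsCompl θ.carrier μ.carrier)
    (h' : IsCompl θ'.carrier μ.carrier) :
    detRatio ℝ (Pperp θ + Pperp μ) (Pperp θ' + Pperp μ) =
      detRatio ℝ (P θ + P μ) (P θ' + P μ) := by
  obtain ⟨-, hu', hr⟩ := isDetRatio_P_add_P hθ h h'
  unfold detRatio
  rw [← detF_conj hr J.mul_neg_self J.neg_self_mul]
  congr 1
  symm
  rw [Ring.eq_mul_inverse_iff_mul_eq _ _ _ (isUnit_Pperp_add_Pperp h'), Pperp_add_Pperp,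
    Pperp_add_Pperp]
  calc _ = J.toCLM * (P θ + P μ) * (Ring.inverse (P θ' + P μ) * (-J.toCLM * J.toCLM) *
          (P θ' + P μ)) * -J.toCLM := by simp only [mul_assoc]
    _ = _ := by
      rw [J.neg_self_mul, mul_one, Ring.inverse_mul_cancel _ hu', mul_one]

theorem isDetRatio_Pperp_sub_Pperp (hθ : AlmostCoincide θ θ') (h : IsCompl θ.carrier μ.carrier)
    (h' : IsCompl θ'.carrier μ.carrier) : IsDetRatio (Pperp θ - Pperp μ) (Pperp θ' - Pperp μ) :=
  .of_sub (isUnit_Pperp_sub_Pperp h) (isUnit_Pperp_sub_Pperp h') (by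
    rw [sub_sub_sub_cancel_right]
    exact isFiniteRank_Pperp_sub_Pperp (isFiniteRank_P_sub_P hθ))

theorem isDetRatio_Pperp_add_Pperp (hθ : AlmostCoincide θ θ') (h : IsCompl θ.carrier μ.carrier)
    (h' : IsCompl θ'.carrier μ.carrier) : IsDetRatio (Pperp θ + Pperp μ) (Pperp θ' + Pperp μ) :=
  .of_sub (isUnit_Pperp_add_Pperp h) (isUnit_Pperp_add_Pperp h') (by
    rw [add_sub_add_right_eq_sub]
    exact isFiniteRank_Pperp_sub_Pperp (isFiniteRank_P_sub_P hθ))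

end Ratio

/-! ### Transition functions along `q` and `p` -/

section Transition

variable {l θ θ' μ : Lagrangian J}

/-- The identities cancel, leaving `(τ_t - τ_μ) τ_l`. The factor `τ_l` does not depend on `t`, so it
drops out of the ratio. -/
theorem qReal_add_qRealPert (l t μ : Lagrangian J) :
    qReal l μ + qRealPert l t = (P t - P μ) * ((2 : ℝ) • tau l) := by
  have : qReal l μ + qRealPert l t = (tau t - tau μ) * tau l := by
    unfold qReal qRealPert
    noncomm_ring
  rw [this, tau, tau, sub_sub_sub_cancel_right, ← smul_sub, smul_mul_assoc, mul_smul_comm]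

theorem isUnit_two_smul_tau (l : Lagrangian J) : IsUnit ((2 : ℝ) • tau l) :=
  ⟨⟨(2 : ℝ) • tau l, (2⁻¹ : ℝ) • tau l, by
    rw [smul_mul_smul_comm, tau_mul_tau]; norm_num, by
    rw [smul_mul_smul_comm, tau_mul_tau]; norm_num⟩, rfl⟩

theorem mul_mul_inverse_mul {R : Type*} [Ring R] {A B C : R} (hC : IsUnit C) :
    A * C * Ring.inverse (B * C) = A * Ring.inverse B := by
  rw [Ring.inverse_mul (.inr hC), ← mul_assoc, Ring.mul_inverse_cancel_right _ _ hC]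

theorem isDetRatio_qReal (h : IsDetRatio (P θ - P μ) (P θ' - P μ)) :
    IsDetRatio (qReal l μ + qRealPert l θ) (qReal l μ + qRealPert l θ') := by
  have hu := isUnit_two_smul_tau l
  rw [qReal_add_qRealPert, qReal_add_qRealPert]
  refine ⟨h.1.mul hu, h.2.1.mul hu, ?_⟩
  rw [mul_mul_inverse_mul hu]
  exact h.2.2

theorem transition_qReal : transition ℝ (qRealPert l θ) (qRealPert l θ') (qReal l μ) =
    detRatio ℝ (P θ - P μ) (P θ' - P μ) := by
  unfold transition detRatio
  rw [qReal_add_qRealPert, qReal_add_qRealPert, mul_mul_inverse_mul (isUnit_two_smul_tau l)]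

theorem p_add_pPert (l t μ : Lagrangian J) : p l μ + pPert l t = Pperp t + Pperp μ := by
  unfold p pPert
  abel

theorem qRealPert_eq (l t : Lagrangian J) :
    qRealPert l t = (P l - P t) * ((-2 : ℝ) • tau l) := by
  have : qRealPert l t = (tau t - tau l) * tau l := by
    rw [sub_mul, tau_mul_tau, qRealPert]
    abel
  rw [this, tau, tau, sub_sub_sub_cancel_right, ← smul_sub, smul_mul_assoc, mul_smul_comm,
    neg_smul, ← smul_neg, ← neg_mul, neg_sub]

theorem isFiniteRank_qRealPert (h : IsFiniteRank (P l - P θ)) : IsFiniteRank (qRealPert l θ) := by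
  rw [qRealPert_eq]
  exact h.mul_right _

theorem isFiniteRank_pPert (h : IsFiniteRank (P l - P θ)) : IsFiniteRank (pPert l θ) := by
  have : pPert l θ = P l - P θ := by
    unfold pPert
    rw [Pperp_eq, Pperp_eq]
    abel
  exact this ▸ h

theorem qPert_apply (l t : Lagrangian J) (x : H) :
    qPert l t (HJ.of J x) = HJ.of J (qRealPert l t x) := rfl

theorem q_add_qPert_apply (l t μ : Lagrangian J) (x : H) :
    (q l μ + qPert l t) (HJ.of J x) = HJ.of J ((qReal l μ + qRealPert l t) x) := rfl

theorem isUnit_complex {S : H →L[ℝ] H} {T : HJ J →L[ℂ] HJ J}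
    (h : ∀ x, T (HJ.of J x) = HJ.of J (S x)) (hS : IsUnit S) : IsUnit T := by
  rw [ContinuousLinearMap.isUnit_iff_bijective] at hS ⊢
  have : (T : HJ J → HJ J) = HJ.of J ∘ S ∘ (HJ.of J).symm := funext fun x => h x
  rw [this]
  exact (HJ.of J).bijective.comp (hS.comp (HJ.of J).symm.bijective)

theorem mul_inverse_complex {A B : H →L[ℝ] H} {A' B' : HJ J →L[ℂ] HJ J}
    (hA : ∀ x, A' (HJ.of J x) = HJ.of J (A x)) (hB : ∀ x, B' (HJ.of J x) = HJ.of J (B x))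
    (hu : IsUnit B) (x : H) :
    (A' * Ring.inverse B') (HJ.of J x) = HJ.of J ((A * Ring.inverse B) x) := by
  have h1 : B (Ring.inverse B x) = x := congr($(Ring.mul_inverse_cancel B hu) x)
  have h2 := congr($(Ring.inverse_mul_cancel B' (isUnit_complex hB hu))
    (HJ.of J (Ring.inverse B x)))
  have h3 : Ring.inverse B' (B' (HJ.of J (Ring.inverse B x))) = HJ.of J (Ring.inverse B x) := h2
  rw [hB, h1] at h3
  exact (congrArg A' h3).trans (hA _)

theorem IsDetRatio.complex {A B : H →L[ℝ] H} {A' B' : HJ J →L[ℂ] HJ J}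
    (hA : ∀ x, A' (HJ.of J x) = HJ.of J (A x)) (hB : ∀ x, B' (HJ.of J x) = HJ.of J (B x))
    (h : IsDetRatio A B) : IsDetRatio A' B' :=
  ⟨isUnit_complex hA h.1, isUnit_complex hB h.2.1, IsFiniteRank.complex
    (S := A * Ring.inverse B - 1) (fun x => by
      rw [sub_apply, sub_apply, map_sub,
        mul_inverse_complex hA hB h.2.1]
      rfl) h.2.2⟩

theorem detRatio_eq_norm_sq {A B : H →L[ℝ] H} {A' B' : HJ J →L[ℂ] HJ J}
    (hA : ∀ x, A' (HJ.of J x) = HJ.of J (A x)) (hB : ∀ x, B' (HJ.of J x) = HJ.of J (B x))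
    (h : IsDetRatio A B) : detRatio ℝ A B = ‖detRatio ℂ A' B'‖ ^ 2 :=
  detF_real_eq_norm_sq (mul_inverse_complex hA hB h.2.1) (h.complex hA hB).2.2

end Transition

end Lagrangian

end QuillenDet

theorem mainTheorem6 {H : Type*} [NormedAddCommGroup H] [InnerProductSpace ℝ H] [CompleteSpace H]
    (J : QuillenDet.ComplexStructure H) (θ θ' μ : QuillenDet.Lagrangian J)
    (hθ : QuillenDet.AlmostCoincide θ θ')
    (hμ : μ ∈ QuillenDet.FredholmLagrangian₀ θ ∩ QuillenDet.FredholmLagrangian₀ θ') :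
    open QuillenDet in
    -- the four Fredholm determinants are defined
    (IsDetRatio (P θ - P μ) (P θ' - P μ) ∧
      IsDetRatio (Pperp θ - Pperp μ) (Pperp θ' - Pperp μ) ∧
      IsDetRatio (P θ + P μ) (P θ' + P μ) ∧
      IsDetRatio (Pperp θ + Pperp μ) (Pperp θ' + Pperp μ)) ∧
    -- and coincide
    (detRatio ℝ (P θ - P μ) (P θ' - P μ) = detRatio ℝ (Pperp θ - Pperp μ) (Pperp θ' - Pperp μ) ∧
      detRatio ℝ (Pperp θ - Pperp μ) (Pperp θ' - Pperp μ) = detRatio ℝ (P θ + P μ) (P θ' + P μ) ∧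
      detRatio ℝ (P θ + P μ) (P θ' + P μ) =
        detRatio ℝ (Pperp θ + Pperp μ) (Pperp θ' + Pperp μ)) ∧
    -- transition functions along `q` and `p`
    ∀ l : Lagrangian J, AlmostCoincide l θ →
      (IsFiniteRank (qPert l θ) ∧ IsFiniteRank (qPert l θ') ∧
        IsFiniteRank (qRealPert l θ) ∧ IsFiniteRank (qRealPert l θ') ∧
        IsFiniteRank (pPert l θ) ∧ IsFiniteRank (pPert l θ')) ∧
      (IsDetRatio (q l μ + qPert l θ) (q l μ + qPert l θ') ∧
        IsDetRatio (qReal l μ + qRealPert l θ) (qReal l μ + qRealPert l θ') ∧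
        IsDetRatio (p l μ + pPert l θ) (p l μ + pPert l θ')) ∧
      -- computed on the real Hilbert space `H`, they agree
      transition ℝ (qRealPert l θ) (qRealPert l θ') (qReal l μ) =
        transition ℝ (pPert l θ) (pPert l θ') (p l μ) ∧
      -- the one along `q`, computed on the complex Hilbert space `H_J`, agrees up to `z ↦ |z|²`
      ‖transition ℂ (qPert l θ) (qPert l θ') (q l μ)‖ ^ 2 =
        transition ℝ (pPert l θ) (pPert l θ') (p l μ) := by
  obtain ⟨h1, h2⟩ := hμ
  have h := QuillenDet.isCompl_of_mem h1
  have h' := QuillenDet.isCompl_of_mem h2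
  have hm := QuillenDet.isDetRatio_P_sub_P hθ h h'
  have hq := QuillenDet.detRatio_Pperp_sub_Pperp (θ := θ) h'
  have hp := QuillenDet.detRatio_P_add_P hθ h h'
  have hpp := QuillenDet.detRatio_Pperp_add_Pperp hθ h h'
  refine ⟨⟨hm, QuillenDet.isDetRatio_Pperp_sub_Pperp hθ h h',
    QuillenDet.isDetRatio_P_add_P hθ h h', QuillenDet.isDetRatio_Pperp_add_Pperp hθ h h'⟩,
    ⟨hq.symm, hq.trans hp.symm, hpp.symm⟩, fun l hl => ?_⟩
  have hf := QuillenDet.isFiniteRank_P_sub_P hl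
  -- Adding the differences for `l, θ` and `θ, θ'` avoids proving that almost coincidence is
  -- transitive.
  have hf' : QuillenDet.IsFiniteRank (QuillenDet.P l - QuillenDet.P θ') := by
    simpa using hf.add (QuillenDet.isFiniteRank_P_sub_P hθ)
  have hfq := QuillenDet.isFiniteRank_qRealPert hf
  have hfq' := QuillenDet.isFiniteRank_qRealPert hf'
  have hr := QuillenDet.isDetRatio_qReal (l := l) hm
  have ht : QuillenDet.transition ℝ (QuillenDet.qRealPert l θ) (QuillenDet.qRealPert l θ')
      (QuillenDet.qReal l μ) = QuillenDet.transition ℝ (QuillenDet.pPert l θ)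
      (QuillenDet.pPert l θ') (QuillenDet.p l μ) := by
    rw [QuillenDet.transition_qReal, QuillenDet.transition, QuillenDet.p_add_pPert,
      QuillenDet.p_add_pPert, hpp, hp]
  refine ⟨⟨hfq.complex (QuillenDet.qPert_apply l θ), hfq'.complex (QuillenDet.qPert_apply l θ'),
    hfq, hfq', QuillenDet.isFiniteRank_pPert hf, QuillenDet.isFiniteRank_pPert hf'⟩,
    ⟨hr.complex (QuillenDet.q_add_qPert_apply l θ μ) (QuillenDet.q_add_qPert_apply l θ' μ), hr,
      ?_⟩, ht, ?_⟩
  · rw [QuillenDet.p_add_pPert, QuillenDet.p_add_pPert]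
    exact QuillenDet.isDetRatio_Pperp_add_Pperp hθ h h'
  · rw [← ht]
    exact (QuillenDet.detRatio_eq_norm_sq (QuillenDet.q_add_qPert_apply l θ μ)
      (QuillenDet.q_add_qPert_apply l θ' μ) hr).symm
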